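/- **Notation.** Let $n,m\ge 1$. Let $\mathcal T$ be the set of real time series $x=(x_1,\dots,x_k)$ of length $1\le k\le n$. A warping path in the grid $[k]\times[m]$ is a sequence of grid points that starts in $(1,1)$, ends in $(k,m)$ and has all its increments in $\{(1,0),(0,1),(1,1)\}$. For such a path $\phi$, let $x\otimes_\phi 0\in\mathbb R^{n\times m}$ be the matrix with entry $x_i$ at $(i,j)\in\phi$ and $0$ elsewhere. The elastic inner product of $x$ with $W\in\mathbb R^{n\times m}$ is $\sigma_W(x)=\max_\phi\langle x\otimes_\phi 0,W\rangle$, the maximum being over all warping paths in $[k]\times[m]$. Let $\Theta=\mathbb R^{n\times m}\times\mathbb R$ with the Euclidean norm. Let $\mathcal Y$ be a measurable space of labels (for instance $\{\pm1\}$ or $\{0,1\}$), let $\ell:\mathcal Y\times\mathbb R\to\mathbb R$ be measurable and let $\lambda\in\mathbb R$ ($\lambda=0$ if there is no regularizer). The loss of the elastic linear classifier with discriminant $f_\theta(x)=b+\sigma_W(x)$, $\theta=(W,b)$, at the labelled series $z=(x,y)$ is $$\ell_z(\theta)=\lambda\|W\|^2+\ell\bigl(y,\,b+\sigma_W(x)\bigr).$$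 Let $P$ be a probability measure on $\mathcal T\times\mathcal Y$ and let $R(\theta)=\int \ell_z(\theta)\,dP(z)$ be the expected risk. For a function $f:\Theta\to\mathbb R$, let $Df(\theta)$ denote its Clarke subdifferential at $\theta$. **Assumptions.** Let $Z\subseteq\Theta$ be a compact convex set and $U\supseteq Z$ an open set such that 1. for $P$-almost every $z$ the loss $\ell_z$ is convex as a function of the parameter $\theta$ on $U$ (which includes that $U$ is convex); a loss that is convex on all of $\Theta$ is admissible for every convex open $U\supseteq Z$; 2. there is $L\in L^2(P)$ such that, for $P$-almost every $z$, $|\ell_z(\theta)-\ell_z(\theta')|\le L(z)\|\theta-\theta'\|$ for all $\theta,\theta'\in U$; 3. $z\mapsto\ell_z(\theta)$ is $P$-integrable for every $\theta\in Z$. Let $\eta^t\ge 0$ be deterministic learning rates with $\sum_t\eta^t=\infty$ and $\sum_t(\eta^t)^2<\infty$. **Method.** On a probability space with a filtration $(\mathcal F_t)_{t\ge0}$, let $z^t$ be $\mathcal F_{t+1}$-measurable, independent of $\mathcal F_t$ and distributed according to $P$, let $\theta^t$ be $\mathcal F_t$-measurable, let $\theta^0\in Z$ almost surely, and suppose that for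 every $t$, almost surely, $$\theta^{t+1}\in\Pi_Z\bigl(\theta^t-\eta^t g^t\bigr)\quad\text{for some generalized gradient } g^t\in D\ell_{z^t}(\theta^t),$$ where $\Pi_Z$ is the metric projection onto $Z$. **Conclusion.** Almost surely, the sequence $(\theta^t)$ converges to a point $\theta^*\in Z$ (which may be random), $R(\theta^t)\to R(\theta^*)$, and $\theta^*$ minimizes the expected risk $R$ over $Z$; in particular, if $\theta^*$ lies in the interior of $Z$, then $\theta^*$ is a local minimum of $R$ on $\Theta$. -/

import Mathlib

open MeasureTheory ProbabilityTheory Filter Topology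

noncomputable section

/-- Real-valued time series of length at least one and at most `n`. The index `k : Fin n` encodes
the length `k + 1`. -/
abbrev TimeSeries (n : ℕ) : Type := Σ k : Fin n, (Fin (k.val + 1) → ℝ)

/-- The admissible steps `(1,0)`, `(0,1)`, `(1,1)` of a warping path. -/
def WarpingStep {k m : ℕ} (s t : Fin k × Fin m) : Prop :=
  (t.1.val = s.1.val + 1 ∧ t.2.val = s.2.val) ∨
  (t.1.val = s.1.val ∧ t.2.val = s.2.val + 1) ∨
  (t.1.val = s.1.val + 1 ∧ t.2.val = s.2.val + 1)

/-- A list of points of the grid `[k] × [m]` (indexed from zero) is a warping path if it starts in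
the first grid point, ends in the last one, and moves by admissible steps. -/
def IsWarpingPath {k m : ℕ} (φ : List (Fin k × Fin m)) : Prop :=
  (∃ h : φ ≠ [],
    ((φ.head h).1.val = 0 ∧ (φ.head h).2.val = 0) ∧
    ((φ.getLast h).1.val + 1 = k ∧ (φ.getLast h).2.val + 1 = m)) ∧
  φ.IsChain WarpingStep

/-- The set of all warping paths in the grid `[k] × [m]`. -/
def WarpingPath (k m : ℕ) : Type := {φ : List (Fin k × Fin m) // IsWarpingPath φ}

/-- The warping paths `𝒫(x)` of a time series `x` for elasticity `m`. -/
abbrev PathsOf {n : ℕ} (m : ℕ) (x : TimeSeries n) : Type := WarpingPath (x.1.val + 1) m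

/-- The elastic embedding of the time series `x` into the matrix `Z` along the warping path `φ`:
the entry `(i, j)` is `x i` if `(i, j)` lies on `φ`, and `Z i j` otherwise. -/
def elasticEmbedding {n m : ℕ} (x : TimeSeries n) (φ : PathsOf m x)
    (Z : Matrix (Fin n) (Fin m) ℝ) : Matrix (Fin n) (Fin m) ℝ :=
  open Classical in
  fun i j => if h : ∃ hi : i.val < x.1.val + 1, (⟨i.val, hi⟩, j) ∈ φ.1
    then x.2 ⟨i.val, h.choose⟩ else Z i j

/-- The Euclidean space of real `n × m` matrices, with the Frobenius norm. -/
abbrev MatrixSpace (n m : ℕ) : Type := EuclideanSpace ℝ (Fin n × Fin m)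

/-- The inner product of the embedding of `x` into the zero matrix along `φ` with `W`. -/
def pathScore {n m : ℕ} (W : MatrixSpace n m) (x : TimeSeries n) (φ : PathsOf m x) : ℝ :=
  ∑ i, ∑ j, elasticEmbedding x φ 0 i j * W (i, j)

/-- The elastic inner product of `x` with parameter `W`: the maximum of the path scores over all
warping paths (see `elasticInner_isGreatest`). -/
def elasticInner {n m : ℕ} (W : MatrixSpace n m) (x : TimeSeries n) : ℝ :=
  ⨆ φ : PathsOf m x, pathScore W x φ

/-- The Euclidean parameter space of pairs `(W, b)` of a weight matrix and a bias. -/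
abbrev ParamSpace (n m : ℕ) : Type := WithLp 2 (MatrixSpace n m × ℝ)

/-- The elastic linear function with parameter `(W, b)`. -/
def elasticLinear {n m : ℕ} (θ : ParamSpace n m) (x : TimeSeries n) : ℝ :=
  θ.snd + elasticInner θ.fst x

/-- The loss of an elastic linear classifier on the labelled time series `z = (x, y)`, as a function
of the parameter `(W, b)`: the value `ℓ y (b + σ_W(x))`, plus an optional regularizer `lam * ‖W‖²`
as in the linear support vector machine. -/
def elasticLoss {n m : ℕ} {Y : Type*} (ℓ : Y → ℝ → ℝ) (lam : ℝ) (z : TimeSeries n × Y)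
    (θ : ParamSpace n m) : ℝ :=
  lam * ‖θ.fst‖ ^ 2 + ℓ z.2 (elasticLinear θ z.1)

/-- The expected risk. -/
def expectedRisk {n m : ℕ} {Y : Type*} [MeasurableSpace Y] (ℓ : Y → ℝ → ℝ) (lam : ℝ)
    (P : Measure (TimeSeries n × Y)) (θ : ParamSpace n m) : ℝ :=
  ∫ z, elasticLoss ℓ lam z θ ∂P

section Nonsmooth

variable {E : Type*} [NormedAddCommGroup E] [InnerProductSpace ℝ E]

/-- The Clarke directional derivative of `f` at `x` in direction `v`, with values in the extended
reals. -/
def clarkeDeriv (f : E → ℝ) (x v : E) : EReal :=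
  limsup (fun p : E × ℝ => (((f (p.1 + p.2 • v) - f p.1) / p.2 : ℝ) : EReal)) (𝓝 x ×ˢ 𝓝[>] 0)

/-- The Clarke subdifferential of `f` at `x`; its elements are the generalized gradients. -/
def clarkeSubdifferential (f : E → ℝ) (x : E) : Set E :=
  {g | ∀ v : E, ((inner ℝ g v : ℝ) : EReal) ≤ clarkeDeriv f x v}

/-- The (set-valued) metric projection of `v` onto `Z`. -/
def metricProjection (Z : Set E) (v : E) : Set E :=
  {p | p ∈ Z ∧ ∀ q ∈ Z, dist v p ≤ dist v q}

end Nonsmooth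

/-- `θ` is a sequence of iterates of the stochastic generalized gradient method with learning rates
`η`, constraint set `Z` and data distribution `P`: the `t`-th example `z t` has law `P` and is
independent of the past `ℱ t`, the iterates are nonanticipating, and each step moves along
the negative of a generalized gradient of the loss on the current example and then projects
onto `Z`. -/
structure IsStochasticGeneralizedGradientMethod {n m : ℕ} {Y Ω : Type*} [MeasurableSpace Y]
    [mΩ : MeasurableSpace Ω] (μ : Measure Ω) (ℱ : Filtration ℕ mΩ)
    (P : Measure (TimeSeries n × Y)) (ℓ : Y → ℝ → ℝ) (lam : ℝ) (Z : Set (ParamSpace n m))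
    (η : ℕ → ℝ) (z : ℕ → Ω → TimeSeries n × Y) (θ : ℕ → Ω → ParamSpace n m) : Prop where
  example_measurable : ∀ t, Measurable[ℱ (t + 1)] (z t)
  example_law : ∀ t, μ.map (z t) = P
  example_indep : ∀ t, Indep (MeasurableSpace.comap (z t) inferInstance) (ℱ t) μ
  iterate_measurable : ∀ t, Measurable[ℱ t] (θ t)
  init_mem : ∀ᵐ ω ∂μ, θ 0 ω ∈ Z
  step : ∀ t, ∀ᵐ ω ∂μ, ∃ g ∈ clarkeSubdifferential (elasticLoss ℓ lam (z t ω)) (θ t ω),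
    θ (t + 1) ω ∈ metricProjection Z (θ t ω - η t • g)

/-- Along a warping path the sum of the two indices increases strictly. -/
theorem warpingStep_lt {k m : ℕ} {s t : Fin k × Fin m} (h : WarpingStep s t) :
    s.1.val + s.2.val < t.1.val + t.2.val := by
  rcases h with h | h | h <;> omega

instance warpingPath_finite (k m : ℕ) : Finite (WarpingPath k m) := by
  have key : ∀ φ : WarpingPath k m, φ.1.Nodup := by
    intro φ
    have h1 : φ.1.IsChain (fun s t => s.1.val + s.2.val < t.1.val + t.2.val) :=
      φ.2.2.imp fun _ _ h => warpingStep_lt h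
    have : IsTrans (Fin k × Fin m) (fun s t => s.1.val + s.2.val < t.1.val + t.2.val) :=
      ⟨fun _ _ _ h h' => lt_trans h h'⟩
    exact (List.isChain_iff_pairwise.mp h1).imp fun h e => by
      subst e; exact lt_irrefl _ h
  exact Finite.of_injective
    (fun φ : WarpingPath k m => (⟨φ.1, key φ⟩ : {l : List (Fin k × Fin m) // l.Nodup}))
    (fun a b h => Subtype.ext (Subtype.mk.inj h))

theorem warpingPath_exists (k m : ℕ) (a : Fin k) (b : Fin m) :
    ∃ (φ : List (Fin k × Fin m)) (h : φ ≠ []),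
      ((φ.head h).1.val = 0 ∧ (φ.head h).2.val = 0) ∧ φ.getLast h = (a, b) ∧
      φ.IsChain WarpingStep := by
  obtain ⟨a, ha⟩ := a
  obtain ⟨b, hb⟩ := b
  induction a with
  | zero =>
    induction b with
    | zero => exact ⟨[(⟨0, ha⟩, ⟨0, hb⟩)], by simp, by simp, by simp, by simp⟩
    | succ b ih =>
      obtain ⟨φ, h, h1, h2, h3⟩ := ih (by omega)
      refine ⟨φ ++ [(⟨0, ha⟩, ⟨b + 1, hb⟩)], by simp, ?_, by simp, ?_⟩
      · rwa [List.head_append_of_ne_nil h]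
      · refine List.isChain_append.mpr ⟨h3, by simp, ?_⟩
        intro s hs t ht
        rw [List.getLast?_eq_getLast_of_ne_nil h, h2] at hs
        simp at hs ht
        subst hs; subst ht
        simp [WarpingStep]
  | succ a ih =>
      obtain ⟨φ, h, h1, h2, h3⟩ := ih (by omega)
      refine ⟨φ ++ [(⟨a + 1, ha⟩, ⟨b, hb⟩)], by simp, ?_, by simp, ?_⟩
      · rwa [List.head_append_of_ne_nil h]
      · refine List.isChain_append.mpr ⟨h3, by simp, ?_⟩
        intro s hs t ht
        rw [List.getLast?_eq_getLast_of_ne_nil h, h2] at hs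
        simp at hs ht
        subst hs; subst ht
        simp [WarpingStep]

theorem warpingPath_nonempty (k m : ℕ) (hk : 0 < k) (hm : 0 < m) : Nonempty (WarpingPath k m) := by
  obtain ⟨φ, h, h1, h2, h3⟩ :=
    warpingPath_exists k m ⟨k - 1, by omega⟩ ⟨m - 1, by omega⟩
  refine ⟨⟨φ, ⟨h, h1, ?_⟩, h3⟩⟩
  rw [h2]
  exact ⟨Nat.sub_add_cancel hk, Nat.sub_add_cancel hm⟩

/-- The supremum in the elastic inner product is an attained maximum. -/
theorem elasticInner_isGreatest {n m : ℕ} (hm : 0 < m) (W : MatrixSpace n m) (x : TimeSeries n) :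
    IsGreatest (Set.range fun φ : PathsOf m x => pathScore W x φ) (elasticInner W x) := by
  have : Nonempty (PathsOf m x) := warpingPath_nonempty _ _ (Nat.succ_pos _) hm
  exact (Set.finite_range _).isCompact.isGreatest_sSup (Set.range_nonempty _)

end

/-! For a convex loss a generalized gradient is a true subgradient, so expanding the square of one
projected step gives, for every `x ∈ Z`, the bound `‖θ⁺ - x‖² ≤ ‖θ - x‖² - 2η (ℓ_z(θ) - ℓ_z(x)) + η²
L(z)²` (`norm_sq_projected_step_le`). The sample is independent of the past, so averaging replaces
`ℓ_z` by the risk `R`. If `x` minimizes `R` over `Z`, the squared distance to `x` is then an almost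
supermartingale with nonnegative decrease `2η (R(θ) - R(x))` and summable error `η² ∫ L²`. Hence the
distance to `x` converges almost surely and the weighted excess risks are summable
(`ae_tendsto_and_summable_of_almost_supermartingale`).

The rest is pathwise. As `∑ η = ∞`, the excess risk is arbitrarily small infinitely often, so by
compactness some cluster point is a minimizer. The distance to it converges and vanishes along a
subsequence, so the whole sequence converges (`exists_tendsto_isMinOn`). This cluster point is
random, whereas each null set belongs to a fixed `x`; a countable dense set of minimizers reconciles
the two.

Warping paths matter only for the joint measurability of the loss. -/

/-! ### Subgradients and one projected step -/

section Subgradient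

variable {E : Type*} [NormedAddCommGroup E] [InnerProductSpace ℝ E]

/-- A generalized gradient of a continuous convex function is a subgradient. -/
theorem inner_le_sub_of_mem_clarkeSubdifferential {f : E → ℝ} {U : Set E} (hU : IsOpen U)
    (hf : ConvexOn ℝ U f) (hc : ContinuousOn f U) {x y g : E} (hx : x ∈ U) (hy : y ∈ U)
    (hg : g ∈ clarkeSubdifferential f x) : inner ℝ g (y - x) ≤ f y - f x := by
  refine le_of_forall_pos_le_add fun ε hε => ?_
  have hlim : Tendsto (fun p : E × ℝ => f (p.1 + (y - x)) - f p.1) (𝓝 x ×ˢ 𝓝[>] 0)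
      (𝓝 (f y - f x)) := by
    have h1 : Tendsto (fun p : E × ℝ => p.1) (𝓝 x ×ˢ 𝓝[>] (0 : ℝ)) (𝓝 x) := tendsto_fst
    have h2 : Tendsto (fun p : E × ℝ => p.1 + (y - x)) (𝓝 x ×ˢ 𝓝[>] (0 : ℝ)) (𝓝 y) := by
      simpa using h1.add_const (y - x)
    exact (((hc.continuousAt (hU.mem_nhds hy)).tendsto).comp h2).sub
      (((hc.continuousAt (hU.mem_nhds hx)).tendsto).comp h1)
  -- For step length in `(0, 1)`, convexity bounds the difference quotient at `p.1` by the full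
  -- increment `f (p.1 + (y - x)) - f p.1`, which tends to `f y - f x` as the base point moves to
  -- `x`.
  have hle : clarkeDeriv f x (y - x) ≤ ((f y - f x + ε : ℝ) : EReal) := by
    refine limsup_le_of_le (by isBoundedDefault) ?_
    have e1 : ∀ᶠ p : E × ℝ in 𝓝 x ×ˢ 𝓝[>] 0, p.1 ∈ U :=
      tendsto_fst.eventually (hU.mem_nhds hx)
    have e2 : ∀ᶠ p : E × ℝ in 𝓝 x ×ˢ 𝓝[>] 0, p.1 + (y - x) ∈ U := by
      have h2 : Tendsto (fun p : E × ℝ => p.1 + (y - x)) (𝓝 x ×ˢ 𝓝[>] (0 : ℝ)) (𝓝 y) := by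
        simpa using (tendsto_fst (f := 𝓝 x) (g := 𝓝[>] (0 : ℝ))).add_const (y - x)
      exact h2.eventually (hU.mem_nhds hy)
    have e3 : ∀ᶠ p : E × ℝ in 𝓝 x ×ˢ 𝓝[>] 0, p.2 ∈ Set.Ioo (0 : ℝ) 1 :=
      tendsto_snd.eventually (Ioo_mem_nhdsGT one_pos)
    have e4 := hlim.eventually (gt_mem_nhds (show f y - f x < f y - f x + ε by linarith))
    filter_upwards [e1, e2, e3, e4] with p h1 h2 h3 h4
    refine EReal.coe_le_coe_iff.mpr (le_trans ?_ h4.le)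
    have := hf.2 h1 h2 (sub_nonneg.mpr h3.2.le) h3.1.le (by ring)
    rw [div_le_iff₀ h3.1]
    have e : (1 - p.2) • p.1 + p.2 • (p.1 + (y - x)) = p.1 + p.2 • (y - x) := by module
    rw [e] at this
    simp only [smul_eq_mul] at this
    linarith
  exact EReal.coe_le_coe_iff.mp ((hg (y - x)).trans hle)

/-- A vector whose inner products with all small displacements are bounded by `K` times their
length has norm at most `K`. -/
theorem norm_le_of_forall_inner_sub_le {U : Set E} {x g : E} {K : ℝ} (hU : U ∈ 𝓝 x)
    (h : ∀ y ∈ U, inner ℝ g (y - x) ≤ K * ‖y - x‖) (hK : 0 ≤ K) : ‖g‖ ≤ K := by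
  by_cases hg : g = 0
  · simpa [hg] using hK
  have ht : Tendsto (fun s : ℝ => x + s • g) (𝓝[>] 0) (𝓝 x) := by
    have : Continuous fun s : ℝ => x + s • g := by fun_prop
    simpa using (this.tendsto 0).mono_left nhdsWithin_le_nhds
  obtain ⟨s, hs, hs0⟩ := ((ht.eventually hU).and self_mem_nhdsWithin).exists
  have hs0 : 0 < s := hs0
  have h1 := h _ hs
  have hg0 : 0 < ‖g‖ := norm_pos_iff.mpr hg
  rw [add_sub_cancel_left, inner_smul_right, norm_smul, real_inner_self_eq_norm_sq,
    Real.norm_of_nonneg hs0.le] at h1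
  have : (s * ‖g‖) * ‖g‖ ≤ (s * ‖g‖) * K := by nlinarith
  exact le_of_mul_le_mul_left this (by positivity)

/-- The metric projection onto a convex set does not increase the distance to its points. -/
theorem norm_sub_le_of_mem_metricProjection {Z : Set E} (hZ : Convex ℝ Z) {v p q : E}
    (hp : p ∈ metricProjection Z v) (hq : q ∈ Z) : ‖p - q‖ ≤ ‖v - q‖ := by
  have : Nonempty Z := ⟨⟨p, hp.1⟩⟩
  have hinf : ‖v - p‖ = ⨅ w : Z, ‖v - w‖ := by
    refine le_antisymm (le_ciInf fun w => ?_) (ciInf_le ⟨0, ?_⟩ (⟨p, hp.1⟩ : Z))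
    · simpa [dist_eq_norm] using hp.2 w w.2
    · rintro _ ⟨w, rfl⟩; exact norm_nonneg _
  -- The variational inequality makes the cross term in the expansion of `‖v - q‖ ^ 2` nonnegative.
  have h := (norm_eq_iInf_iff_real_inner_le_zero hZ hp.1).mp hinf q hq
  have e : v - q = (v - p) + (p - q) := by abel
  have h2 : ‖v - q‖ ^ 2 = ‖v - p‖ ^ 2 + 2 * inner ℝ (v - p) (p - q) + ‖p - q‖ ^ 2 := by
    rw [e, norm_add_sq_real]
  have h3 : inner ℝ (v - p) (p - q) = - inner ℝ (v - p) (q - p) := by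
    rw [← inner_neg_right, neg_sub]
  refine (pow_le_pow_iff_left₀ (norm_nonneg _) (norm_nonneg _) two_ne_zero).mp ?_
  nlinarith [sq_nonneg ‖v - p‖]

/-- One step of the projected subgradient method. -/
theorem norm_sq_projected_step_le {f : E → ℝ} {Z U : Set E} (hZ : Convex ℝ Z) (hU : IsOpen U)
    (hZU : Z ⊆ U) (hf : ConvexOn ℝ U f) {K : ℝ}
    (hLip : ∀ x ∈ U, ∀ y ∈ U, |f x - f y| ≤ K * ‖x - y‖) {x y g p : E} {s : ℝ} (hs : 0 ≤ s)
    (hx : x ∈ Z) (hy : y ∈ Z) (hg : g ∈ clarkeSubdifferential f x)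
    (hp : p ∈ metricProjection Z (x - s • g)) :
    ‖p - y‖ ^ 2 ≤ ‖x - y‖ ^ 2 + (-(2 * s) * (f x - f y) + s ^ 2 * K ^ 2) := by
  have hc : ContinuousOn f U := by
    have : LipschitzOnWith (Real.toNNReal K) f U := LipschitzOnWith.of_dist_le_mul fun a ha b hb => by
      rw [Real.dist_eq, dist_eq_norm]
      exact (hLip a ha b hb).trans
        (mul_le_mul_of_nonneg_right (Real.le_coe_toNNReal K) (norm_nonneg _))
    exact this.continuousOn
  have hsub : ∀ w ∈ U, inner ℝ g (w - x) ≤ f w - f x := fun w hw =>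
    inner_le_sub_of_mem_clarkeSubdifferential hU hf hc (hZU hx) hw hg
  -- The sign of `K` is not assumed. If `g ≠ 0`, a short move along `g` gives a second point of `U`,
  -- which forces `0 ≤ K`.
  have hgK : ‖g‖ ^ 2 ≤ K ^ 2 := by
    by_cases hg0 : g = 0
    · simpa [hg0] using sq_nonneg K
    have hK : 0 ≤ K := by
      by_contra hK
      have ht : Tendsto (fun s : ℝ => x + s • g) (𝓝[>] 0) (𝓝 x) := by
        have : Continuous fun s : ℝ => x + s • g := by fun_prop
        simpa using (this.tendsto 0).mono_left nhdsWithin_le_nhds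
      obtain ⟨r, hr, hr0⟩ :=
        ((ht.eventually (hU.mem_nhds (hZU hx))).and self_mem_nhdsWithin).exists
      have hr0 : 0 < r := hr0
      have h1 := (abs_nonneg _).trans (hLip _ hr _ (hZU hx))
      rw [add_sub_cancel_left] at h1
      have : 0 < ‖r • g‖ := norm_pos_iff.mpr (smul_ne_zero hr0.ne' hg0)
      nlinarith
    refine pow_le_pow_left₀ (norm_nonneg _) (norm_le_of_forall_inner_sub_le
      (hU.mem_nhds (hZU hx)) (fun w hw => (hsub w hw).trans ?_) hK) 2
    exact (le_abs_self _).trans (hLip w hw x (hZU hx))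
  have h1 := pow_le_pow_left₀ (norm_nonneg _) (norm_sub_le_of_mem_metricProjection hZ hp hy) 2
  have e : x - s • g - y = (x - y) - s • g := by abel
  rw [e, norm_sub_sq_real (x - y), inner_smul_right, norm_smul, mul_pow, Real.norm_eq_abs, sq_abs,
    real_inner_comm] at h1
  have h2 := hsub y (hZU hy)
  have h3 : inner ℝ g (y - x) = - inner ℝ g (x - y) := by rw [← inner_neg_right, neg_sub]
  have h4 := mul_le_mul_of_nonneg_left hgK (sq_nonneg s)
  have h5 := mul_le_mul_of_nonneg_left h2 hs
  rw [h3] at h5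
  linarith

end Subgradient

/-! ### Deterministic convergence criteria -/

section Convergence

variable {E : Type*} [NormedAddCommGroup E]

/-- A sequence whose distances to the points of a dense subset of `M` converge, and which has a
cluster point in `M`, converges. -/
theorem tendsto_of_tendsto_norm_sub {u : ℕ → E} {M D : Set E} (hD : M ⊆ closure D)
    (hconv : ∀ x ∈ D, ∃ c, Tendsto (fun t => ‖u t - x‖ ^ 2) atTop (𝓝 c)) {p : E} (hp : p ∈ M)
    {φ : ℕ → ℕ} (hφ : StrictMono φ) (hu : Tendsto (u ∘ φ) atTop (𝓝 p)) :
    Tendsto u atTop (𝓝 p) := by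
  refine Metric.tendsto_atTop'.mpr fun ε hε => ?_
  obtain ⟨x, hxD, hx⟩ := Metric.mem_closure_iff.mp (hD hp) (ε / 3) (by positivity)
  obtain ⟨c, hc⟩ := hconv x hxD
  have h1 : Tendsto (fun k => ‖u (φ k) - x‖ ^ 2) atTop (𝓝 (‖p - x‖ ^ 2)) :=
    ((hu.sub_const x).norm).pow 2
  -- The full sequence of distances has a limit, so the subsequence determines it.
  have hcx : c = ‖p - x‖ ^ 2 := tendsto_nhds_unique (hc.comp hφ.tendsto_atTop) h1
  rw [dist_eq_norm] at hx
  have hlt : c < (ε / 2) ^ 2 := by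
    rw [hcx]; exact pow_lt_pow_left₀ (by linarith) (norm_nonneg _) two_ne_zero
  obtain ⟨N, hN⟩ := eventually_atTop.mp (hc.eventually (gt_mem_nhds hlt))
  refine ⟨N, fun t ht => ?_⟩
  have h2 : ‖u t - x‖ < ε / 2 := lt_of_pow_lt_pow_left₀ 2 (by positivity) (hN t ht.le)
  have h3 := norm_sub_le_norm_sub_add_norm_sub (u t) x p
  rw [norm_sub_rev x p] at h3
  rw [dist_eq_norm]
  linarith

/-- Along a nonsummable sequence of weights, a nonnegative sequence with a finite weighted sum
comes arbitrarily close to zero. -/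
theorem frequently_lt_of_summable_mul {η δ : ℕ → ℝ} (hη : ∀ t, 0 ≤ η t) (hηsum : ¬ Summable η)
    (hs : Summable fun t => η t * δ t) {ε : ℝ} (hε : 0 < ε) : ∃ᶠ t in atTop, δ t < ε := by
  intro h
  -- If eventually `ε ≤ δ t`, then `η t ≤ η t * δ t / ε`, and `η` would be summable.
  refine hηsum ?_
  refine (hs.mul_right ε⁻¹).of_norm_bounded_eventually_nat ?_
  filter_upwards [h] with t ht
  rw [Real.norm_of_nonneg (hη t), ← div_eq_mul_inv, le_div_iff₀ hε]
  exact mul_le_mul_of_nonneg_left (not_lt.mp ht) (hη t)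

/-- A Fejér-type criterion for the convergence of a sequence to a minimizer. -/
theorem exists_tendsto_isMinOn {Z D : Set E} {F : E → ℝ} (hZ : IsCompact Z)
    (hF : ContinuousOn F Z) {x₀ : E} (hmin : IsMinOn F Z x₀)
    (hD : {x ∈ Z | F x = F x₀} ⊆ closure D)
    {η : ℕ → ℝ} (hη : ∀ t, 0 ≤ η t) (hηsum : ¬ Summable η) {u : ℕ → E} (hu : ∀ t, u t ∈ Z)
    (hconv : ∀ x ∈ D, ∃ c, Tendsto (fun t => ‖u t - x‖ ^ 2) atTop (𝓝 c))
    (hs : Summable fun t => η t * (F (u t) - F x₀)) :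
    ∃ p ∈ Z, Tendsto u atTop (𝓝 p) ∧ Tendsto (fun t => F (u t)) atTop (𝓝 (F p)) ∧
      IsMinOn F Z p := by
  -- Along `φ` the excess over the minimum is below `1 / (k + 1)`; a further subsequence `ψ`
  -- converges, by compactness, to a minimizer `p`.
  obtain ⟨φ, hφ, hφlt⟩ := extraction_forall_of_frequently fun k : ℕ =>
    frequently_lt_of_summable_mul hη hηsum hs (Nat.one_div_pos_of_nat (α := ℝ) (n := k))
  obtain ⟨p, hpZ, ψ, hψ, hψp⟩ := hZ.tendsto_subseq fun k => hu (φ k)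
  have hFlim : ∀ {v : ℕ → E}, (∀ t, v t ∈ Z) → Tendsto v atTop (𝓝 p) →
      Tendsto (fun t => F (v t)) atTop (𝓝 (F p)) := fun hv h =>
    (hF p hpZ).tendsto.comp (tendsto_nhdsWithin_iff.mpr ⟨h, Eventually.of_forall hv⟩)
  have h1 : Tendsto (fun k => F (u (φ (ψ k)))) atTop (𝓝 (F p)) :=
    hFlim (v := fun k => u (φ (ψ k))) (fun _ => hu _) hψp
  have h2 : Tendsto (fun k => 1 / ((ψ k : ℝ) + 1)) atTop (𝓝 0) :=
    tendsto_one_div_add_atTop_nhds_zero_nat.comp hψ.tendsto_atTop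
  have hle : F p - F x₀ ≤ 0 :=
    le_of_tendsto_of_tendsto' (h1.sub_const _) h2 fun k => (hφlt (ψ k)).le
  have hpM : F p = F x₀ := le_antisymm (by linarith) (hmin hpZ)
  have hup := tendsto_of_tendsto_norm_sub hD hconv ⟨hpZ, hpM⟩ (hφ.comp hψ) hψp
  exact ⟨p, hpZ, hup, hFlim hu hup, fun x hx => hpM.trans_le (hmin hx)⟩

end Convergence

/-! ### Fresh samples and almost supermartingales -/

section Stochastic

variable {Ω : Type*} {m mΩ : MeasurableSpace Ω} {μ : Measure Ω} [IsProbabilityMeasure μ]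

/-- On an event of the past, a fresh sample and a variable determined by the past are
independent. -/
theorem map_restrict_prodMk_eq_prod {S E : Type*} [MeasurableSpace S] [MeasurableSpace E]
    {P : Measure S} [IsProbabilityMeasure P] (hm : m ≤ mΩ) {X : Ω → S}
    {T : Ω → E} (hX : Measurable X) (hXP : μ.map X = P)
    (hind : Indep (MeasurableSpace.comap X inferInstance) m μ) (hT : Measurable[m] T)
    {A : Set Ω} (hA : MeasurableSet[m] A) :
    (μ.restrict A).map (fun ω => (X ω, T ω)) = P.prod ((μ.restrict A).map T) := by
  have hT' : Measurable T := hT.mono hm le_rfl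
  -- It suffices to test rectangles; the event `T ⁻¹' t ∩ A` belongs to the past, so independence
  -- factors its intersection with `X ⁻¹' s`.
  refine (Measure.prod_eq fun s t hs ht => ?_).symm
  rw [Measure.map_apply (hX.prodMk hT') (hs.prod ht), Measure.map_apply hT' ht, ← hXP,
    Measure.map_apply hX hs, Measure.restrict_apply ((hX.prodMk hT') (hs.prod ht)),
    Measure.restrict_apply (hT' ht),
    ← (Indep_iff _ _ _).mp hind _ _ ⟨s, hs, rfl⟩ ((hT ht).inter hA)]
  congr 1
  ext ω
  simp [and_assoc]

/-- The joint law of `X` and `T` is a product measure, so this is Fubini's theorem transported along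
`T`. -/
theorem integrable_integral_of_indep {S E : Type*} [MeasurableSpace S] [MeasurableSpace E]
    {P : Measure S} [IsProbabilityMeasure P] (hm : m ≤ mΩ) {X : Ω → S}
    {T : Ω → E} (hX : Measurable X) (hXP : μ.map X = P)
    (hind : Indep (MeasurableSpace.comap X inferInstance) m μ) (hT : Measurable[m] T)
    {h : S → E → ℝ} (hh : Measurable (Function.uncurry h))
    (hint : Integrable (fun ω => h (X ω) (T ω)) μ) :
    Integrable (fun ω => ∫ s, h s (T ω) ∂P) μ := by
  have hT' : Measurable T := hT.mono hm le_rfl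
  have hmap := map_restrict_prodMk_eq_prod hm hX hXP hind hT MeasurableSet.univ
  rw [Measure.restrict_univ] at hmap
  have h1 : Integrable (Function.uncurry h) (P.prod (μ.map T)) := by
    rw [← hmap, integrable_map_measure hh.aestronglyMeasurable (hX.prodMk hT').aemeasurable]
    exact hint
  exact h1.integral_prod_right.comp_measurable hT'

/-- The mean over a fresh sample may be taken first. -/
theorem setIntegral_eq_setIntegral_integral_of_indep {S E : Type*} [MeasurableSpace S]
    [MeasurableSpace E] {P : Measure S} [IsProbabilityMeasure P] (hm : m ≤ mΩ) {X : Ω → S} {T : Ω → E} (hX : Measurable X) (hXP : μ.map X = P)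
    (hind : Indep (MeasurableSpace.comap X inferInstance) m μ) (hT : Measurable[m] T)
    {h : S → E → ℝ} (hh : Measurable (Function.uncurry h))
    (hint : Integrable (fun ω => h (X ω) (T ω)) μ) {A : Set Ω} (hA : MeasurableSet[m] A) :
    ∫ ω in A, h (X ω) (T ω) ∂μ = ∫ ω in A, ∫ s, h s (T ω) ∂P ∂μ := by
  have hT' : Measurable T := hT.mono hm le_rfl
  have hmap := map_restrict_prodMk_eq_prod hm hX hXP hind hT hA
  have h1 : Integrable (Function.uncurry h) (P.prod ((μ.restrict A).map T)) := by
    rw [← hmap, integrable_map_measure hh.aestronglyMeasurable (hX.prodMk hT').aemeasurable]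
    exact hint.integrableOn
  calc ∫ ω in A, h (X ω) (T ω) ∂μ
      = ∫ p, Function.uncurry h p ∂((μ.restrict A).map fun ω => (X ω, T ω)) :=
        (integral_map (hX.prodMk hT').aemeasurable hh.aestronglyMeasurable).symm
    _ = ∫ e, ∫ s, h s e ∂P ∂((μ.restrict A).map T) := by
        rw [hmap, integral_prod_symm _ h1]; rfl
    _ = _ := integral_map hT'.aemeasurable
        hh.stronglyMeasurable.integral_prod_left.aestronglyMeasurable

/-- A bounded almost supermartingale converges, and its total decrease is finite. -/
theorem ae_tendsto_and_summable_of_almost_supermartingale {ℱ : Filtration ℕ mΩ}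
    {V D : ℕ → Ω → ℝ} {c : ℕ → ℝ} {B : ℝ} (hV : ∀ t, StronglyMeasurable[ℱ t] (V t))
    (hV0 : ∀ t, ∀ᵐ ω ∂μ, 0 ≤ V t ω) (hVB : ∀ t, ∀ᵐ ω ∂μ, V t ω ≤ B)
    (hD : ∀ t, Integrable (D t) μ) (hD0 : ∀ t, ∀ᵐ ω ∂μ, 0 ≤ D t ω) (hc0 : ∀ t, 0 ≤ c t)
    (hc : Summable c)
    (hstep : ∀ t A, MeasurableSet[ℱ t] A →
      ∫ ω in A, V (t + 1) ω ∂μ ≤ ∫ ω in A, V t ω + (-D t ω + c t) ∂μ) :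
    (∀ᵐ ω ∂μ, ∃ l, Tendsto (fun t => V t ω) atTop (𝓝 l)) ∧
      ∀ᵐ ω ∂μ, Summable fun t => D t ω := by
  have hVi : ∀ t, Integrable (V t) μ := fun t =>
    Integrable.of_bound ((hV t).mono (ℱ.le t)).aestronglyMeasurable B (by
      filter_upwards [hV0 t, hVB t] with ω h0 hB
      rwa [Real.norm_of_nonneg h0])
  have hsplit : ∀ t A, ∫ ω in A, V t ω + (-D t ω + c t) ∂μ
      = ∫ ω in A, V t ω ∂μ - ∫ ω in A, D t ω ∂μ + μ.real A * c t := fun t A => by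
    have h1 : Integrable (fun ω => -D t ω) (μ.restrict A) := (hD t).neg.integrableOn
    have h2 : Integrable (fun _ => c t) (μ.restrict A) := integrable_const _
    rw [integral_add (g := fun ω => -D t ω + c t) (hVi t).integrableOn (h1.add h2), integral_add h1 h2, integral_neg,
      setIntegral_const, smul_eq_mul]
    ring
  simp only [hsplit] at hstep
  constructor
  -- Subtracting the accumulated errors `s` turns `V` into a genuine supermartingale, since the
  -- decrease `D` is nonnegative; it is bounded by `B + ∑' i, c i`.
  · set s : ℕ → ℝ := fun t => ∑ i ∈ Finset.range t, c i with hs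
    have hsup : Supermartingale (fun t ω => V t ω - s t) ℱ μ := by
      refine supermartingale_of_setIntegral_succ_le
        (fun t => (hV t).sub stronglyMeasurable_const)
        (fun t => (hVi t).sub (integrable_const _)) fun t A hA => ?_
      rw [integral_sub (hVi _).integrableOn integrableOn_const,
        integral_sub (hVi _).integrableOn integrableOn_const, setIntegral_const,
        setIntegral_const, smul_eq_mul, smul_eq_mul]
      have h1 := hstep t A hA
      have h2 : 0 ≤ ∫ ω in A, D t ω ∂μ :=
        integral_nonneg_of_ae (ae_restrict_of_ae (hD0 t))
      have h3 : s (t + 1) = s t + c t := Finset.sum_range_succ _ _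
      rw [h3]
      linarith
    have hbdd : ∀ t, eLpNorm ((-fun t ω => V t ω - s t) t) 1 μ ≤
        ((B + ∑' i, c i).toNNReal : ENNReal) := fun t => by
      have := eLpNorm_le_of_ae_bound (p := 1) (μ := μ) (C := B + ∑' i, c i)
        (f := (-fun t ω => V t ω - s t) t) (by
          filter_upwards [hV0 t, hVB t] with ω h0 hB
          have h1 : s t ≤ ∑' i, c i := hc.sum_le_tsum _ fun i _ => hc0 i
          have h2 : 0 ≤ s t := Finset.sum_nonneg fun i _ => hc0 i
          simp only [Pi.neg_apply, norm_neg, Real.norm_eq_abs]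
          rw [abs_le]
          constructor <;> linarith)
      simpa [ENNReal.ofReal] using this
    filter_upwards [hsup.neg.exists_ae_tendsto_of_bdd hbdd] with ω ⟨l, hl⟩
    -- Convergence was obtained for the negated process, so `l` is the limit of `s t - V t`.
    refine ⟨∑' i, c i - l, ?_⟩
    have := hc.hasSum.tendsto_sum_nat.sub hl
    refine this.congr fun t => ?_
    simp [hs]
  · have hsum : Summable fun t => ∫ ω, D t ω ∂μ := by
      refine summable_of_sum_range_le (c := B + ∑' i, c i)
        (fun t => integral_nonneg_of_ae (hD0 t)) fun t => ?_
      -- The one-step inequality on the whole space telescopes.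
      have key : ∀ t, ∑ i ∈ Finset.range t, ∫ ω, D i ω ∂μ + ∫ ω, V t ω ∂μ
          ≤ ∫ ω, V 0 ω ∂μ + ∑ i ∈ Finset.range t, c i := by
        intro t
        induction t with
        | zero => simp
        | succ t ih =>
          have h1 := hstep t Set.univ MeasurableSet.univ
          simp only [Measure.restrict_univ, probReal_univ, one_mul] at h1
          rw [Finset.sum_range_succ, Finset.sum_range_succ]
          linarith
      have h0 : 0 ≤ ∫ ω, V t ω ∂μ := integral_nonneg_of_ae (hV0 t)
      have hB : ∫ ω, V 0 ω ∂μ ≤ B := by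
        simpa using integral_mono_ae (hVi 0) (integrable_const B) (hVB 0)
      have h1 : ∑ i ∈ Finset.range t, c i ≤ ∑' i, c i := hc.sum_le_tsum _ fun i _ => hc0 i
      linarith [key t]
    have hfin : ∑' t, eLpNorm (D t) 1 μ ≠ ⊤ := by
      have : ∀ t, eLpNorm (D t) 1 μ = ENNReal.ofReal (∫ ω, D t ω ∂μ) := fun t => by
        rw [eLpNorm_one_eq_lintegral_enorm, ofReal_integral_eq_lintegral_ofReal (hD t) (hD0 t)]
        refine lintegral_congr_ae ?_
        filter_upwards [hD0 t] with ω h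
        exact Real.enorm_of_nonneg h
      simp only [this]
      exact hsum.tsum_ofReal_ne_top
    filter_upwards [summable_norm_of_tsum_eLpNorm_ne_top le_rfl
      (fun t => (hD t).aestronglyMeasurable) hfin] with ω h
    exact h.of_norm

end Stochastic

/-! ### Joint measurability of the elastic loss -/

section Measurability

theorem continuous_elasticInner {n m : ℕ} (x : TimeSeries n) :
    Continuous fun W : MatrixSpace n m => elasticInner W x := by
  have : Fintype (PathsOf m x) := Fintype.ofFinite _
  -- For `m = 0` there is no path and the supremum is a constant default value; otherwise it is a
  -- finite maximum of linear functions of `W`.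
  rcases isEmpty_or_nonempty (PathsOf m x) with h | h
  · simpa [elasticInner, iSup_of_empty'] using continuous_const
  · simp only [elasticInner, ← Finset.sup'_univ_eq_ciSup]
    refine Continuous.finset_sup'_apply _ fun φ _ => ?_
    unfold pathScore
    fun_prop

theorem measurable_elasticEmbedding {n m : ℕ} (k : Fin n) (φ : WarpingPath (k.val + 1) m)
    (A : Matrix (Fin n) (Fin m) ℝ) (i : Fin n) (j : Fin m) :
    Measurable fun v : Fin (k.val + 1) → ℝ =>
      elasticEmbedding (⟨k, v⟩ : TimeSeries n) φ A i j := by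
  -- Whether the cell lies on the path does not depend on the values `v`, so the entry is either a
  -- coordinate of `v` or a constant.
  by_cases h : ∃ hi : i.val < k.val + 1, ((⟨i.val, hi⟩ : Fin (k.val + 1)), j) ∈ φ.1
  · have e : ∀ v : Fin (k.val + 1) → ℝ,
        elasticEmbedding (⟨k, v⟩ : TimeSeries n) φ A i j = v ⟨i.val, h.choose⟩ :=
      fun v => dif_pos h
    simp only [e]
    exact measurable_pi_apply _
  · have e : ∀ v : Fin (k.val + 1) → ℝ,
        elasticEmbedding (⟨k, v⟩ : TimeSeries n) φ A i j = A i j := fun v => dif_neg h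
    simp only [e]
    exact measurable_const

/-- Measurability on the sigma type is tested on each length separately, and there the set of paths
is fixed and finite. -/
theorem measurable_elasticInner {n m : ℕ} (W : MatrixSpace n m) :
    Measurable fun x : TimeSeries n => elasticInner W x := by
  intro s hs
  refine MeasurableSpace.measurableSet_iInf.mpr fun k => ?_
  have hφ : ∀ φ : WarpingPath (k.val + 1) m, Measurable fun v : Fin (k.val + 1) → ℝ =>
      pathScore W (⟨k, v⟩ : TimeSeries n) φ := fun φ =>
    Finset.measurable_sum _ fun i _ => Finset.measurable_sum _ fun j _ =>
      (measurable_elasticEmbedding k φ 0 i j).mul_const _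
  have : Measurable fun v : Fin (k.val + 1) → ℝ => elasticInner W (⟨k, v⟩ : TimeSeries n) :=
    Measurable.iSup hφ
  exact this hs

/-- The elastic inner product is a Carathéodory function, continuous in `W` and measurable in `x`,
hence jointly measurable. Joint measurability is what the Fubini arguments require. -/
theorem measurable_uncurry_elasticLoss {n m : ℕ} {Y : Type*} [MeasurableSpace Y]
    {ℓ : Y → ℝ → ℝ} (hℓ : Measurable (Function.uncurry ℓ)) (lam : ℝ) :
    Measurable (Function.uncurry (elasticLoss (n := n) (m := m) ℓ lam)) := by
  have h1 : Measurable (Function.uncurry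
      fun (W : MatrixSpace n m) (x : TimeSeries n) => elasticInner W x) :=
    measurable_uncurry_of_continuous_of_measurable continuous_elasticInner measurable_elasticInner
  have hfst : Measurable fun p : (TimeSeries n × Y) × ParamSpace n m => p.2.fst :=
    (WithLp.continuous_fst 2 _ _).measurable.comp measurable_snd
  have hsnd : Measurable fun p : (TimeSeries n × Y) × ParamSpace n m => p.2.snd :=
    (WithLp.continuous_snd 2 _ _).measurable.comp measurable_snd
  have h2 : Measurable fun p : (TimeSeries n × Y) × ParamSpace n m =>
      elasticInner p.2.fst p.1.1 :=
    h1.comp (hfst.prodMk (measurable_fst.comp measurable_fst))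
  exact ((hfst.norm.pow_const 2).const_mul lam).add
    (hℓ.comp ((measurable_snd.comp measurable_fst).prodMk (hsnd.add h2)))

end Measurability

/-- The mean of a random Lipschitz function is continuous. -/
theorem continuousOn_integral_of_lipschitz {E S : Type*} [NormedAddCommGroup E]
    [MeasurableSpace S] {P : Measure S} {f : S → E → ℝ} {Z : Set E} {L : S → ℝ}
    (hL : Integrable L P)
    (hLip : ∀ᵐ s ∂P, ∀ x ∈ Z, ∀ y ∈ Z, |f s x - f s y| ≤ L s * ‖x - y‖)
    (hint : ∀ x ∈ Z, Integrable (fun s => f s x) P) :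
    ContinuousOn (fun y => ∫ s, f s y ∂P) Z := by
  have : LipschitzOnWith (∫ s, L s ∂P).toNNReal (fun y => ∫ s, f s y ∂P) Z :=
    LipschitzOnWith.of_dist_le_mul fun x hx y hy => by
      rw [Real.dist_eq, dist_eq_norm, ← integral_sub (hint x hx) (hint y hy)]
      refine (abs_integral_le_integral_abs).trans ?_
      refine (integral_mono_ae ((hint x hx).sub (hint y hy)).abs (hL.mul_const ‖x - y‖) ?_).trans ?_
      · filter_upwards [hLip] with s hs using hs x hx y hy
      · rw [integral_mul_const]
        exact mul_le_mul_of_nonneg_right (Real.le_coe_toNNReal _) (norm_nonneg _)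
  exact this.continuousOn

/-! ### Projected stochastic subgradient method -/

section Method

variable {E : Type*} [NormedAddCommGroup E] [InnerProductSpace ℝ E] [MeasurableSpace E]
  [BorelSpace E] {S : Type*} [MeasurableSpace S]
  {Ω : Type*} [mΩ : MeasurableSpace Ω]

/-- The squared distance of the projected stochastic subgradient method to a minimizer of the mean
of a random convex function converges, and the weighted excess risks are summable. -/
theorem ae_tendsto_norm_sub_sq_and_summable {P : Measure S} [IsProbabilityMeasure P]
    {f : S → E → ℝ} (hf : Measurable (Function.uncurry f)) {Z U : Set E} (hZ : IsCompact Z)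
    (hZconv : Convex ℝ Z) (hU : IsOpen U) (hZU : Z ⊆ U) (hconvex : ∀ᵐ s ∂P, ConvexOn ℝ U (f s))
    {L : S → ℝ} (hLm : Measurable L) (hL : MemLp L 2 P)
    (hLip : ∀ᵐ s ∂P, ∀ x ∈ U, ∀ y ∈ U, |f s x - f s y| ≤ L s * ‖x - y‖)
    (hint : ∀ x ∈ Z, Integrable (fun s => f s x) P)
    {η : ℕ → ℝ} (hη : ∀ t, 0 ≤ η t) (hηsq : Summable fun t => η t ^ 2)
    {μ : Measure Ω} [IsProbabilityMeasure μ] {ℱ : Filtration ℕ mΩ} {X : ℕ → Ω → S}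
    {θ : ℕ → Ω → E} (hX : ∀ t, Measurable (X t)) (hXP : ∀ t, μ.map (X t) = P)
    (hind : ∀ t, Indep (MeasurableSpace.comap (X t) inferInstance) (ℱ t) μ)
    (hθ : ∀ t, Measurable[ℱ t] (θ t)) (hθZ : ∀ t, ∀ᵐ ω ∂μ, θ t ω ∈ Z)
    (hstep : ∀ t, ∀ᵐ ω ∂μ, ∃ g ∈ clarkeSubdifferential (f (X t ω)) (θ t ω),
      θ (t + 1) ω ∈ metricProjection Z (θ t ω - η t • g))
    {x : E} (hx : x ∈ Z) (hmin : IsMinOn (fun y => ∫ s, f s y ∂P) Z x) :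
    (∀ᵐ ω ∂μ, ∃ l, Tendsto (fun t => ‖θ t ω - x‖ ^ 2) atTop (𝓝 l)) ∧
      ∀ᵐ ω ∂μ, Summable fun t => 2 * η t * ((∫ s, f s (θ t ω) ∂P) - ∫ s, f s x ∂P) := by
  obtain ⟨B, hB⟩ := Metric.isBounded_iff.mp hZ.isBounded
  have hB' : ∀ y ∈ Z, ‖y - x‖ ≤ B := fun y hy => by simpa [dist_eq_norm] using hB hy hx
  have hae : ∀ t {p : S → Prop}, (∀ᵐ s ∂P, p s) → ∀ᵐ ω ∂μ, p (X t ω) := fun t p hp =>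
    ae_of_ae_map (hX t).aemeasurable (by rwa [hXP t])
  set C := ∫ s, L s ^ 2 ∂P
  -- This is the increment allowed by `norm_sq_projected_step_le` for the sample `s` at the iterate
  -- `y`.
  set h : ℕ → S → E → ℝ := fun t s y => -(2 * η t) * (f s y - f s x) + η t ^ 2 * L s ^ 2 with hh
  have hhm : ∀ t, Measurable (Function.uncurry (h t)) := fun t => by
    have h1 : Measurable fun p : S × E => f p.1 x := hf.comp (measurable_fst.prodMk measurable_const)
    exact ((hf.sub h1).const_mul _).add
      (((hLm.comp measurable_fst).pow_const 2).const_mul _)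
  have hθm : ∀ t, Measurable (θ t) := fun t => (hθ t).mono (ℱ.le t) le_rfl
  have hhi : ∀ t, Integrable (fun ω => h t (X t ω) (θ t ω)) μ := fun t => by
    have hL' : MemLp L 2 (μ.map (X t)) := by rwa [hXP t]
    have i1 : Integrable (fun ω => L (X t ω)) μ :=
      (hL'.integrable one_le_two).comp_measurable (hX t)
    have i2 : Integrable (fun ω => L (X t ω) ^ 2) μ := hL'.integrable_sq.comp_measurable (hX t)
    refine ((i1.abs.mul_const B).const_mul (2 * η t) |>.add (i2.const_mul (η t ^ 2))).mono'
      ((hhm t).comp ((hX t).prodMk (hθm t))).aestronglyMeasurable ?_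
    filter_upwards [hθZ t, hae t hLip] with ω h1 h2
    have h3 : |f (X t ω) (θ t ω) - f (X t ω) x| ≤ |L (X t ω)| * B :=
      (h2 _ (hZU h1) _ (hZU hx)).trans (mul_le_mul (le_abs_self _) (hB' _ h1) (norm_nonneg _)
        (abs_nonneg _))
    refine (norm_add_le _ _).trans (add_le_add ?_ ?_)
    · rw [Real.norm_eq_abs, abs_mul, abs_neg, abs_of_nonneg (mul_nonneg zero_le_two (hη t))]
      exact mul_le_mul_of_nonneg_left h3 (mul_nonneg zero_le_two (hη t))
    · rw [Real.norm_of_nonneg (by positivity)]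
  have hmean : ∀ t, ∀ y ∈ Z, ∫ s, h t s y ∂P =
      -(2 * η t * ((∫ s, f s y ∂P) - ∫ s, f s x ∂P)) + η t ^ 2 * C := fun t y hy => by
    have i1 : Integrable (fun s => -(2 * η t) * (f s y - f s x)) P :=
      ((hint y hy).sub (hint x hx)).const_mul _
    rw [integral_add i1 (hL.integrable_sq.const_mul _), integral_const_mul, integral_const_mul,
      integral_sub (hint y hy) (hint x hx), neg_mul]
  have hmean_ae : ∀ t, (fun ω => ∫ s, h t s (θ t ω) ∂P) =ᵐ[μ] fun ω =>
      -(2 * η t * ((∫ s, f s (θ t ω) ∂P) - ∫ s, f s x ∂P)) + η t ^ 2 * C := fun t => by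
    filter_upwards [hθZ t] with ω hω using hmean t _ hω
  have hmi : ∀ t, Integrable (fun ω => ∫ s, h t s (θ t ω) ∂P) μ := fun t =>
    integrable_integral_of_indep (ℱ.le t) (hX t) (hXP t) (hind t) (hθ t) (hhm t) (hhi t)
  have hVm : ∀ t, StronglyMeasurable[ℱ t] fun ω => ‖θ t ω - x‖ ^ 2 := fun t =>
    ((show Continuous fun y : E => ‖y - x‖ ^ 2 by fun_prop).measurable.comp
      (hθ t)).stronglyMeasurable
  have hVB : ∀ t, ∀ᵐ ω ∂μ, ‖θ t ω - x‖ ^ 2 ≤ B ^ 2 := fun t => by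
    filter_upwards [hθZ t] with ω hω using pow_le_pow_left₀ (norm_nonneg _) (hB' _ hω) 2
  have hVi : ∀ t, Integrable (fun ω => ‖θ t ω - x‖ ^ 2) μ := fun t =>
    Integrable.of_bound ((hVm t).mono (ℱ.le t)).aestronglyMeasurable (B ^ 2) (by
      filter_upwards [hVB t] with ω h
      rwa [Real.norm_of_nonneg (by positivity)])
  refine ae_tendsto_and_summable_of_almost_supermartingale (ℱ := ℱ) (c := fun t => η t ^ 2 * C)
    (B := B ^ 2) hVm (fun t => ae_of_all _ fun ω => by positivity) hVB (fun t => ?_) (fun t => ?_)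
    (fun t => mul_nonneg (sq_nonneg _) (integral_nonneg fun s => sq_nonneg _))
    (hηsq.mul_right C) fun t A hA => ?_
  -- The excess risk inherits integrability from the mean of `h`, since almost surely it is `η t ^ 2
  -- * C` minus that mean.
  · refine ((integrable_const (η t ^ 2 * C)).sub (hmi t)).congr ?_
    filter_upwards [hmean_ae t] with ω hω
    rw [Pi.sub_apply, hω]
    ring
  · filter_upwards [hθZ t] with ω hω
    exact mul_nonneg (mul_nonneg zero_le_two (hη t)) (sub_nonneg.mpr (hmin hω))
  · have h1 : ∫ ω in A, ‖θ (t + 1) ω - x‖ ^ 2 ∂μ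
        ≤ ∫ ω in A, ‖θ t ω - x‖ ^ 2 + h t (X t ω) (θ t ω) ∂μ := by
      refine integral_mono_ae (hVi _).integrableOn ((hVi t).add (hhi t)).integrableOn
        (ae_restrict_of_ae ?_)
      filter_upwards [hθZ t, hstep t, hae t hLip, hae t hconvex] with ω h1 h2 h3 h4
      obtain ⟨g, hg, hp⟩ := h2
      exact norm_sq_projected_step_le hZconv hU hZU h4 h3 (hη t) h1 hx hg hp
    refine h1.trans_eq ?_
    rw [integral_add (hVi t).integrableOn (hhi t).integrableOn,
      setIntegral_eq_setIntegral_integral_of_indep (ℱ.le t) (hX t) (hXP t) (hind t) (hθ t)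
        (hhm t) (hhi t) hA, ← integral_add (hVi t).integrableOn (hmi t).integrableOn]
    refine integral_congr_ae (ae_restrict_of_ae ?_)
    filter_upwards [hmean_ae t] with ω hω
    rw [hω]

/-- Almost sure convergence of the projected stochastic subgradient method for a random convex
function. -/
theorem ae_exists_tendsto_isMinOn [SecondCountableTopology E] {P : Measure S} [IsProbabilityMeasure P]
    {f : S → E → ℝ} (hf : Measurable (Function.uncurry f)) {Z U : Set E} (hZ : IsCompact Z)
    (hZconv : Convex ℝ Z) (hU : IsOpen U) (hZU : Z ⊆ U) (hconvex : ∀ᵐ s ∂P, ConvexOn ℝ U (f s))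
    {L : S → ℝ} (hL : MemLp L 2 P)
    (hLip : ∀ᵐ s ∂P, ∀ x ∈ U, ∀ y ∈ U, |f s x - f s y| ≤ L s * ‖x - y‖)
    (hint : ∀ x ∈ Z, Integrable (fun s => f s x) P)
    {η : ℕ → ℝ} (hη : ∀ t, 0 ≤ η t) (hηsum : ¬ Summable η) (hηsq : Summable fun t => η t ^ 2)
    {μ : Measure Ω} [IsProbabilityMeasure μ] {ℱ : Filtration ℕ mΩ} {X : ℕ → Ω → S}
    {θ : ℕ → Ω → E} (hX : ∀ t, Measurable (X t)) (hXP : ∀ t, μ.map (X t) = P)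
    (hind : ∀ t, Indep (MeasurableSpace.comap (X t) inferInstance) (ℱ t) μ)
    (hθ : ∀ t, Measurable[ℱ t] (θ t)) (hinit : ∀ᵐ ω ∂μ, θ 0 ω ∈ Z)
    (hstep : ∀ t, ∀ᵐ ω ∂μ, ∃ g ∈ clarkeSubdifferential (f (X t ω)) (θ t ω),
      θ (t + 1) ω ∈ metricProjection Z (θ t ω - η t • g)) :
    ∀ᵐ ω ∂μ, ∃ p ∈ Z, Tendsto (fun t => θ t ω) atTop (𝓝 p) ∧
      Tendsto (fun t => ∫ s, f s (θ t ω) ∂P) atTop (𝓝 (∫ s, f s p ∂P)) ∧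
      IsMinOn (fun y => ∫ s, f s y ∂P) Z p := by
  have hθZ : ∀ t, ∀ᵐ ω ∂μ, θ t ω ∈ Z := by
    rintro (_ | t)
    · exact hinit
    · filter_upwards [hstep t] with ω ⟨_, _, h⟩ using h.1
  have hne : Z.Nonempty := let ⟨ω, hω⟩ := hinit.exists; ⟨_, hω⟩
  have hcont : ContinuousOn (fun y => ∫ s, f s y ∂P) Z := by
    refine continuousOn_integral_of_lipschitz (hL.integrable one_le_two) ?_ hint
    filter_upwards [hLip] with s hs x hx y hy using hs x (hZU hx) y (hZU hy)
  -- A measurable version of the modulus is needed for the joint measurability of the increment `h`.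
  obtain ⟨L', hL'm, hLL'⟩ := hL.1.aemeasurable
  have hL'2 : MemLp L' 2 P := (memLp_congr_ae hLL').mp hL
  have hLip' : ∀ᵐ s ∂P, ∀ x ∈ U, ∀ y ∈ U, |f s x - f s y| ≤ L' s * ‖x - y‖ := by
    filter_upwards [hLip, hLL'] with s h1 h2
    rwa [← h2]
  have key := fun x (hx : x ∈ Z) (hmin : IsMinOn (fun y => ∫ s, f s y ∂P) Z x) =>
    ae_tendsto_norm_sub_sq_and_summable hf hZ hZconv hU hZU hconvex hL'm hL'2 hLip' hint hη hηsq
      hX hXP hind hθ hθZ hstep hx hmin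
  obtain ⟨x₀, hx₀, hmin⟩ := hZ.exists_isMinOn hne hcont
  -- Countability of `D` yields one null set valid for all its points; density suffices for the
  -- pathwise criterion.
  obtain ⟨D, hDM, hDc, hD⟩ := (TopologicalSpace.IsSeparable.of_separableSpace
    {x ∈ Z | ∫ s, f s x ∂P = ∫ s, f s x₀ ∂P}).exists_countable_dense_subset
  have hconv : ∀ᵐ ω ∂μ, ∀ x ∈ D, ∃ l, Tendsto (fun t => ‖θ t ω - x‖ ^ 2) atTop (𝓝 l) :=
    (ae_ball_iff hDc).mpr fun x hx => (key x (hDM hx).1 fun y hy =>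
      (hDM hx).2.trans_le (hmin hy)).1
  filter_upwards [hconv, (key x₀ hx₀ hmin).2, ae_all_iff.mpr hθZ] with ω h1 h2 h3
  refine exists_tendsto_isMinOn hZ hcont hmin hD hη hηsum h3 h1 ?_
  refine (h2.mul_left (1 / 2)).congr fun t => ?_
  ring

end Method

/-! ### Specialization to the elastic loss -/

theorem mainTheorem3 {n m : ℕ} (hm : 0 < m)
    {Y : Type*} [MeasurableSpace Y]
    -- the loss, the regularization parameter and the data distribution
    (ℓ : Y → ℝ → ℝ) (hℓ : Measurable (Function.uncurry ℓ)) (lam : ℝ)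
    (P : Measure (TimeSeries n × Y)) [IsProbabilityMeasure P]
    -- the constraint set and an open neighbourhood of it
    (Z U : Set (ParamSpace n m)) (hZ : IsCompact Z) (hZconv : Convex ℝ Z)
    (hU : IsOpen U) (hZU : Z ⊆ U)
    -- the loss is convex in the parameter, with a square integrable Lipschitz modulus,
    -- and the expected risk is well defined
    (hconvex : ∀ᵐ z ∂P, ConvexOn ℝ U (elasticLoss ℓ lam z))
    (L : TimeSeries n × Y → ℝ) (hL : MemLp L 2 P)
    (hLip : ∀ᵐ z ∂P, ∀ θ ∈ U, ∀ θ' ∈ U,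
      |elasticLoss ℓ lam z θ - elasticLoss ℓ lam z θ'| ≤ L z * ‖θ - θ'‖)
    (hint : ∀ θ ∈ Z, Integrable (fun z => elasticLoss ℓ lam z θ) P)
    -- the learning rates
    (η : ℕ → ℝ) (hη : ∀ t, 0 ≤ η t) (hηsum : ¬ Summable η) (hηsq : Summable fun t => η t ^ 2)
    -- a run of the stochastic generalized gradient method
    {Ω : Type*} [mΩ : MeasurableSpace Ω] (μ : Measure Ω) [IsProbabilityMeasure μ]
    (ℱ : Filtration ℕ mΩ) (z : ℕ → Ω → TimeSeries n × Y) (θ : ℕ → Ω → ParamSpace n m)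
    (hθ : IsStochasticGeneralizedGradientMethod μ ℱ P ℓ lam Z η z θ) :
    ∀ᵐ ω ∂μ, ∃ θ' ∈ Z,
      Tendsto (fun t => θ t ω) atTop (𝓝 θ') ∧
      Tendsto (fun t => expectedRisk ℓ lam P (θ t ω)) atTop (𝓝 (expectedRisk ℓ lam P θ')) ∧
      IsMinOn (expectedRisk ℓ lam P) Z θ' ∧
      (θ' ∈ interior Z → IsLocalMin (expectedRisk ℓ lam P) θ') := by
  filter_upwards [ae_exists_tendsto_isMinOn (measurable_uncurry_elasticLoss hℓ lam) hZ hZconv hU hZU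
    hconvex hL hLip hint hη hηsum hηsq
    (fun t => (hθ.example_measurable t).mono (ℱ.le (t + 1)) le_rfl) hθ.example_law
    hθ.example_indep hθ.iterate_measurable hθ.init_mem hθ.step] with ω ⟨p, hp, h1, h2, h3⟩
  exact ⟨p, hp, h1, h2, h3, fun hi => h3.isLocalMin (mem_interior_iff_mem_nhds.mp hi)⟩
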